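/- Let $d\ge 1$. For $v\in\mathbb S^{d-1}$ and $\theta\in(0,\frac{\pi}{2}]$ let $$V(v,\theta)=\Big\{h\in\mathbb R^d\setminus\{0\}\ \Big|\ \frac{|\langle v,h\rangle|}{|h|}>\cos\theta\Big\}$$ be the open double cone with axis $v$ and apex angle $\theta$, and let $\mathcal V$ be the family of all these double cones. For a map $\Gamma:\mathbb Z^d\to\mathcal V$ (a configuration) let $G(\Gamma)$ be the graph with vertex set $\mathbb Z^d$ that has a directed edge from $x$ to $y$ whenever $y\in x+\Gamma(x)$. An undirected edge path in $G(\Gamma)$ is a finite walk in which consecutive vertices are joined by an edge in at least one of the two directions. Let $\vartheta>0$ and $R_0>0$. Then there exist positive integers $N$ and $M$ and a constant $\lambda\ge R_0$, depending only on $d$, $\vartheta$ and $R_0$, such that for every configuration $\Gamma:\mathbb Z^d\to\mathcal V$ all of whose double cones have apex angle at least $\vartheta$ there is a family $(p_{xy})_{x,y\in\mathbb Z^d}$ of undirected edge paths in $G(\Gamma)$ with the following properties: 1. The path $p_{xy}$ starts at $x$ and ends at $y$. 2. Each path $p_{xy}$ has at most $N$ edges. 3. Each undirected edge of $G(\Gamma)$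 is used by $p_{xy}$ for at most $M$ pairs $(x,y)\in\mathbb Z^d\times\mathbb Z^d$. 4. Each edge $\{u,w\}$ of $p_{xy}$ satisfies $\lambda^{-1}|x-y|\le|u-w|\le\lambda|x-y|$, where $|\cdot|$ is the Euclidean norm. -/

import Mathlib

open scoped Pointwise

noncomputable section

/-- The (open, single) cone with apex at the origin, axis `v` and apex angle `ϑ`. -/
def openCone {d : ℕ} (v : EuclideanSpace ℝ (Fin d)) (ϑ : ℝ) : Set (EuclideanSpace ℝ (Fin d)) :=
  {h | h ≠ 0 ∧ Real.cos ϑ < inner ℝ v h / ‖h‖}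

/-- The parameters of a double cone in `ℝ^d` with apex at the origin: a unit vector spanning the
symmetry axis, and an apex angle in `(0, π/2]`. The vectors `v` and `-v` span the same axis and
give the same set of points. -/
structure DoubleCone (d : ℕ) where
  axis : EuclideanSpace ℝ (Fin d)
  norm_axis : ‖axis‖ = 1
  apex : ℝ
  apex_pos : 0 < apex
  apex_le : apex ≤ Real.pi / 2

/-- The set of points of a double cone: a cone together with its reflection in the origin. -/
def DoubleCone.points {d : ℕ} (V : DoubleCone d) : Set (EuclideanSpace ℝ (Fin d)) :=
  openCone V.axis V.apex ∪ -openCone V.axis V.apex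

/-- The point of Euclidean space `ℝ^d` given by an element of the integer lattice `ℤ^d`. -/
def latticePoint {d : ℕ} (x : Fin d → ℤ) : EuclideanSpace ℝ (Fin d) :=
  WithLp.toLp 2 fun i => (x i : ℝ)

/-- The Euclidean distance between two elements of the integer lattice. -/
def latticeDist {d : ℕ} (x y : Fin d → ℤ) : ℝ :=
  ‖latticePoint x - latticePoint y‖

/-- The directed graph of a configuration `Γ` on the integer lattice: there is an edge from `x`
to `y` if `y ∈ x + Γ(x)`. -/
def coneDigraph {d : ℕ} (Γ : (Fin d → ℤ) → DoubleCone d) : Digraph (Fin d → ℤ) where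
  Adj x y := latticePoint y ∈ latticePoint x +ᵥ (Γ x).points

/-- The undirected graph underlying `coneDigraph Γ`: two different lattice points are adjacent if
there is a directed edge between them in at least one of the two directions. -/
def coneGraph {d : ℕ} (Γ : (Fin d → ℤ) → DoubleCone d) : SimpleGraph (Fin d → ℤ) :=
  (coneDigraph Γ).toSimpleGraphInclusive

end

/-!
The path from `x` to `y` is a greedy walk at the scale `r = 2 ^ k ≈ |x - y|`.

*Why a walk along cones can reach any target.* A double cone with apex angle at least `ϑ` contains,
for every direction `n`, a vector of bounded length whose inner product with `n` is bounded below: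
tilt the axis slightly towards `n`, after choosing the half of the double cone on the side of `n`.
So from every point there is an edge of bounded length that decreases the distance to a given
target `p`, as long as that distance exceeds a constant. Take for `p` a point deep inside the cone
of `y`: when the walk comes near `p`, it is inside the cone of `y`, and one last edge leads to `y`.
The lemma on cones, `exists_lattice_ball_subset_points`, gives an integral vector `h` such that a
whole ball around `h` lies in the cone. Hence, if the lattice is cut into blocks of side `r`, a
point in the block `b` is adjacent to all points in the block `b + h`, and the greedy walk may be
run on the indices of the blocks. Its number of steps is bounded independently of `r`, since the
square of the distance to the target is a natural number that decreases.

*Why each edge is used boundedly often.* The position of the walk inside each block can be chosen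
freely. Let `q` and `q'` be the positions of `x` and `y` in their blocks, in the group `(ℤ/r)^d`.
The positions along the path are chosen to be `q, q + q', q, q + q', …, q'`, so that any two
consecutive ones determine `q` and `q'`. The blocks of `x` and `y` are a bounded number of blocks
away from every vertex of the path, and the length of an edge determines `k` up to boundedly many
values. Hence an edge determines the pair `(x, y)` up to boundedly many possibilities
(`exists_finset_of_isRoutedEdge`, `exists_Icc_of_scale`).
-/

/-! ### Lattice points -/

theorem latticePoint_add {d : ℕ} (x y : Fin d → ℤ) :
    latticePoint (x + y) = latticePoint x + latticePoint y := by
  ext i; simp [latticePoint]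

theorem latticePoint_sub {d : ℕ} (x y : Fin d → ℤ) :
    latticePoint (x - y) = latticePoint x - latticePoint y := by
  ext i; simp [latticePoint]

theorem norm_le_sqrt_of_abs_le_one {d : ℕ} (v : EuclideanSpace ℝ (Fin d)) (h : ∀ i, |v i| ≤ 1) :
    ‖v‖ ≤ √d := by
  rw [EuclideanSpace.norm_eq]
  apply Real.sqrt_le_sqrt
  calc ∑ i, ‖v i‖ ^ 2 ≤ ∑ _i : Fin d, (1 : ℝ) := by
        refine Finset.sum_le_sum fun i _ => ?_
        exact pow_le_one₀ (norm_nonneg _) (h i)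
    _ = d := by simp

theorem exists_norm_sub_latticePoint_le {d : ℕ} (v : EuclideanSpace ℝ (Fin d)) :
    ∃ h : Fin d → ℤ, ‖latticePoint h - v‖ ≤ √d := by
  refine ⟨fun i => round (v i), norm_le_sqrt_of_abs_le_one _ fun i => ?_⟩
  have := abs_sub_round (v i)
  rw [abs_sub_comm] at this
  simp only [latticePoint, PiLp.sub_apply]
  linarith

theorem norm_latticePoint_sq {d : ℕ} (x : Fin d → ℤ) :
    ‖latticePoint x‖ ^ 2 = ((∑ i, (x i).natAbs ^ 2 : ℕ) : ℝ) := by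
  rw [EuclideanSpace.norm_sq_eq]
  simp [latticePoint, Nat.cast_natAbs]

theorem one_le_norm_latticePoint {d : ℕ} {x : Fin d → ℤ} (hx : x ≠ 0) :
    1 ≤ ‖latticePoint x‖ := by
  obtain ⟨i, hi⟩ := Function.ne_iff.mp hx
  have h1 : (1 : ℝ) ≤ |(x i : ℝ)| := by exact_mod_cast Int.one_le_abs hi
  exact h1.trans (PiLp.norm_apply_le (latticePoint x) i)

theorem finite_norm_latticePoint_le (d : ℕ) (C : ℝ) :
    {x : Fin d → ℤ | ‖latticePoint x‖ ≤ C}.Finite := by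
  refine (Set.finite_Icc (fun _ : Fin d => -⌈C⌉) (fun _ => ⌈C⌉)).subset fun x hx => ?_
  have h : ∀ i, |x i| ≤ ⌈C⌉ := fun i => by
    have h1 : |(x i : ℝ)| ≤ C := (PiLp.norm_apply_le (latticePoint x) i).trans hx
    exact_mod_cast h1.trans (Int.le_ceil C)
  exact ⟨fun i => (abs_le.mp (h i)).1, fun i => (abs_le.mp (h i)).2⟩

/-! ### Double cones -/

theorem zero_notMem_points {d : ℕ} (V : DoubleCone d) : 0 ∉ V.points := by
  simp [DoubleCone.points, openCone]

theorem smul_mem_points {d : ℕ} {V : DoubleCone d} {g : EuclideanSpace ℝ (Fin d)} {r : ℝ}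
    (hr : 0 < r) (hg : g ∈ V.points) : r • g ∈ V.points := by
  -- The greedy walk, by induction on a bound on the squared distance to the target.
  have key : ∀ g ∈ openCone V.axis V.apex, r • g ∈ openCone V.axis V.apex := by
    rintro g ⟨h0, h⟩
    refine ⟨smul_ne_zero hr.ne' h0, ?_⟩
    rwa [inner_smul_right, norm_smul, Real.norm_of_nonneg hr.le, mul_div_mul_left _ _ hr.ne']
  rcases hg with h | h
  · exact Or.inl (key g h)
  · right
    have := key _ h
    rwa [smul_neg] at this

theorem coneGraph_adj_of_sub_mem {d : ℕ} {Γ : (Fin d → ℤ) → DoubleCone d} {u w : Fin d → ℤ}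
    (h : latticePoint w - latticePoint u ∈ (Γ u).points) : (coneGraph Γ).Adj u w := by
  refine ⟨?_, Or.inl ?_⟩
  · rintro rfl
    rw [sub_self] at h
    exact zero_notMem_points _ h
  · change latticePoint w ∈ latticePoint u +ᵥ (Γ u).points
    rw [Set.mem_vadd_set_iff_neg_vadd_mem, vadd_eq_add, neg_add_eq_sub]
    exact h

/-- A cone contains the balls of radius `2 * s * K` around the points `K • v` of its axis, when `s`
is small compared with the apex angle. -/
theorem mem_openCone_of_norm_sub_le {d : ℕ} {v g : EuclideanSpace ℝ (Fin d)} (hv : ‖v‖ = 1)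
    {a κ s K : ℝ} (ha : Real.cos a ≤ κ) (hκ : 0 ≤ κ) (hs : κ * (1 + 2 * s) < 1 - 2 * s)
    (hK : 0 < K) (hg : ‖g - K • v‖ ≤ 2 * s * K) : g ∈ openCone v a := by
  have h1 : inner ℝ v g = K + inner ℝ v (g - K • v) := by
    rw [inner_sub_right, inner_smul_right, real_inner_self_eq_norm_sq, hv]; ring
  have h2 : -(2 * s * K) ≤ inner ℝ v (g - K • v) := by
    have := abs_real_inner_le_norm v (g - K • v)
    rw [hv, one_mul] at this
    linarith [(abs_le.mp (this.trans hg)).1]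
  have h3 : ‖g‖ ≤ K * (1 + 2 * s) := by
    have := norm_add_le (g - K • v) (K • v)
    rw [sub_add_cancel, norm_smul, hv, Real.norm_of_nonneg hK.le] at this
    linarith
  have h4 : κ * ‖g‖ < inner ℝ v g := by
    have h5 : κ * ‖g‖ ≤ κ * (K * (1 + 2 * s)) := mul_le_mul_of_nonneg_left h3 hκ
    have h6 := mul_lt_mul_of_pos_left hs hK
    linarith
  have hg0 : g ≠ 0 := by
    rintro rfl
    simp at h4
  exact ⟨hg0, ha.trans_lt ((lt_div_iff₀ (norm_pos_iff.mpr hg0)).mpr h4)⟩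

/-- For every direction `n`, a double cone with apex angle at least `ϑ` contains a ball of given
radius `ρ` around an integral vector of bounded length that makes progress in the direction
of `n`. -/
theorem exists_lattice_ball_subset_points (d : ℕ) {ϑ ρ : ℝ} (hϑ : 0 < ϑ) (hρ : 0 ≤ ρ) :
    ∃ C : ℝ, 0 ≤ C ∧ ∀ V : DoubleCone d, ϑ ≤ V.apex → ∀ n : EuclideanSpace ℝ (Fin d),
      ∃ h : Fin d → ℤ, ‖latticePoint h‖ ≤ C ∧
        (∀ e : EuclideanSpace ℝ (Fin d), ‖e‖ ≤ ρ → latticePoint h + e ∈ V.points) ∧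
        ρ * ‖n‖ ≤ inner ℝ (latticePoint h) n := by
  set κ := Real.cos (min ϑ (Real.pi / 2))
  have hmin : 0 < min ϑ (Real.pi / 2) := lt_min hϑ (by positivity)
  have hκ0 : 0 ≤ κ := Real.cos_nonneg_of_mem_Icc
    ⟨by linarith [Real.pi_pos], min_le_right _ _⟩
  have hκ1 : κ < 1 := by
    rw [← Real.cos_zero]
    exact Real.cos_lt_cos_of_nonneg_of_le_pi_div_two le_rfl (min_le_right _ _) hmin
  set s := (1 - κ) / 8 with hs
  have hs0 : 0 < s := by linarith
  -- The axis may be tilted by `s`: then `κ (1 + 2 s) < 1 - 2 s`. The length `K` is such that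
  -- `K * s` exceeds `ρ` plus the error of rounding to the lattice.
  have hκs : κ * (1 + 2 * s) < 1 - 2 * s := by rw [hs]; nlinarith
  have hd : 0 ≤ √(d : ℝ) := Real.sqrt_nonneg _
  set K := (ρ + √d + 1) / s with hK
  have hKs : K * s = ρ + √d + 1 := by rw [hK]; field_simp
  have hK0 : 0 < K := by positivity
  refine ⟨√d + K * (1 + s), by positivity, fun V hV n => ?_⟩
  have hcos : Real.cos V.apex ≤ κ := Real.cos_le_cos_of_nonneg_of_le_pi hmin.le
    (by linarith [V.apex_le, Real.pi_pos]) ((min_le_left _ _).trans hV)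
  -- Of the two halves of the double cone, take the one on the side of `n`.
  obtain ⟨v, hv, hvn, hsub⟩ : ∃ v : EuclideanSpace ℝ (Fin d), ‖v‖ = 1 ∧ 0 ≤ inner ℝ v n ∧
      openCone v V.apex ⊆ V.points := by
    rcases le_total 0 (inner ℝ V.axis n) with h | h
    · exact ⟨V.axis, V.norm_axis, h, Set.subset_union_left⟩
    · refine ⟨-V.axis, by rw [norm_neg, V.norm_axis], by rw [inner_neg_left]; linarith, ?_⟩
      rintro g ⟨h0, hg⟩
      right
      refine ⟨neg_ne_zero.mpr h0, ?_⟩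
      simpa using hg
  -- Tilting the axis slightly towards `n` gives a positive inner product with `n`.
  obtain ⟨n', hn', hnn'⟩ : ∃ n' : EuclideanSpace ℝ (Fin d), ‖n'‖ ≤ 1 ∧ inner ℝ n' n = ‖n‖ := by
    refine ⟨‖n‖⁻¹ • n, ?_, ?_⟩
    · rw [norm_smul, norm_inv, norm_norm]
      exact inv_mul_le_one
    · rw [real_inner_smul_left, real_inner_self_eq_norm_sq, sq]
      by_cases h : ‖n‖ = 0
      · simp [h]
      · field_simp
  obtain ⟨h, hh⟩ := exists_norm_sub_latticePoint_le (K • (v + s • n'))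
  have hsn : ‖s • n'‖ ≤ s := by
    rw [norm_smul, Real.norm_of_nonneg hs0.le]; nlinarith
  refine ⟨h, ?_, fun e he => hsub ?_, ?_⟩
  · have h1 := norm_add_le (latticePoint h - K • (v + s • n')) (K • (v + s • n'))
    rw [sub_add_cancel, norm_smul, Real.norm_of_nonneg hK0.le] at h1
    have h2 := norm_add_le v (s • n')
    have h3 : K * ‖v + s • n'‖ ≤ K * (1 + s) := mul_le_mul_of_nonneg_left (by linarith) hK0.le
    linarith
  · refine mem_openCone_of_norm_sub_le hv hcos hκ0 hκs hK0 ?_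
    have h1 : latticePoint h + e - K • v
        = (latticePoint h - K • (v + s • n')) + e + K • (s • n') := by
      rw [smul_add]; abel
    have h2 : ‖K • (s • n')‖ ≤ K * s := by
      rw [norm_smul, Real.norm_of_nonneg hK0.le]
      exact mul_le_mul_of_nonneg_left hsn hK0.le
    rw [h1]
    refine (norm_add₃_le).trans ?_
    linarith
  · have h1 : inner ℝ (latticePoint h) n = K * inner ℝ v n + K * s * ‖n‖ +
        inner ℝ (latticePoint h - K • (v + s • n')) n := by
      rw [inner_sub_left, real_inner_smul_left, inner_add_left, real_inner_smul_left, hnn']; ring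
    have h2 : -(√d * ‖n‖) ≤ inner ℝ (latticePoint h - K • (v + s • n')) n := by
      have h3 := abs_real_inner_le_norm (latticePoint h - K • (v + s • n')) n
      have h4 : ‖latticePoint h - K • (v + s • n')‖ * ‖n‖ ≤ √d * ‖n‖ :=
        mul_le_mul_of_nonneg_right hh (norm_nonneg _)
      linarith [(abs_le.mp (h3.trans h4)).1]
    have h3 : 0 ≤ K * inner ℝ v n := mul_nonneg hK0.le hvn
    rw [h1, hKs]
    linarith [norm_nonneg n]

/-! ### Blocks of side `r` -/

/-- The index of the block of side `r` that contains `x`: the cubes `r • b + [0, r)^d` with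
`b ∈ ℤ^d` partition the lattice. -/
def blockIndex {d : ℕ} (r : ℕ) (x : Fin d → ℤ) : Fin d → ℤ := fun i => x i / r

/-- The position of `x` inside its block of side `r`, as an element of the group `(ℤ/r)^d`. -/
def residue {d : ℕ} (r : ℕ) (x : Fin d → ℤ) : Fin d → ZMod r := fun i => (x i : ZMod r)

/-- The lattice point of position `q` in the block of side `r` and index `b`. -/
def blockPoint {d : ℕ} (r : ℕ) (b : Fin d → ℤ) (q : Fin d → ZMod r) : Fin d → ℤ :=
  fun i => r * b i + (q i).val

section Blocks

variable {d r : ℕ} [NeZero r]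

theorem blockIndex_blockPoint (b : Fin d → ℤ) (q : Fin d → ZMod r) :
    blockIndex r (blockPoint r b q) = b := by
  ext i
  have hr : (r : ℤ) ≠ 0 := by exact_mod_cast NeZero.ne r
  have h : ((q i).val : ℤ) / r = 0 :=
    Int.ediv_eq_zero_of_lt (by positivity) (by exact_mod_cast ZMod.val_lt (q i))
  simp only [blockIndex, blockPoint]
  rw [Int.add_comm, Int.add_mul_ediv_left _ _ hr, h, zero_add]

theorem residue_blockPoint (b : Fin d → ℤ) (q : Fin d → ZMod r) :
    residue r (blockPoint r b q) = q := by
  ext i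
  simp [residue, blockPoint]

theorem blockPoint_blockIndex_residue (x : Fin d → ℤ) :
    blockPoint r (blockIndex r x) (residue r x) = x := by
  ext i
  simp only [blockPoint, blockIndex, residue]
  rw [ZMod.val_intCast]
  exact Int.mul_ediv_add_emod _ _

/-- Up to the factor `r`, the difference of two lattice points is the difference of the indices of
their blocks, with an error bounded independently of `r`. -/
theorem exists_latticePoint_sub_eq (u w : Fin d → ℤ) :
    ∃ e : EuclideanSpace ℝ (Fin d), ‖e‖ ≤ √d ∧ latticePoint w - latticePoint u =
      (r : ℝ) • (latticePoint (blockIndex r w - blockIndex r u) + e) := by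
  have hr : (0 : ℝ) < r := by exact_mod_cast NeZero.pos r
  refine ⟨WithLp.toLp 2 fun i => (((w i % r : ℤ) : ℝ) - ((u i % r : ℤ) : ℝ)) / r, ?_, ?_⟩
  · refine norm_le_sqrt_of_abs_le_one _ fun i => ?_
    have hr' : (0 : ℤ) < r := by exact_mod_cast NeZero.pos r
    have h1 : (0 : ℝ) ≤ ((w i % r : ℤ) : ℝ) := by exact_mod_cast Int.emod_nonneg _ hr'.ne'
    have h2 : (0 : ℝ) ≤ ((u i % r : ℤ) : ℝ) := by exact_mod_cast Int.emod_nonneg _ hr'.ne'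
    have h3 : ((w i % r : ℤ) : ℝ) < r := by exact_mod_cast Int.emod_lt_of_pos _ hr'
    have h4 : ((u i % r : ℤ) : ℝ) < r := by exact_mod_cast Int.emod_lt_of_pos _ hr'
    rw [abs_div, abs_of_pos hr, div_le_one hr, abs_le]
    constructor <;> linarith
  · ext i
    have h1 : (w i : ℝ) = r * ((w i / r : ℤ) : ℝ) + ((w i % r : ℤ) : ℝ) := by
      exact_mod_cast (Int.mul_ediv_add_emod (w i) r).symm
    have h2 : (u i : ℝ) = r * ((u i / r : ℤ) : ℝ) + ((u i % r : ℤ) : ℝ) := by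
      exact_mod_cast (Int.mul_ediv_add_emod (u i) r).symm
    simp only [latticePoint, blockIndex, PiLp.sub_apply, PiLp.smul_apply, PiLp.add_apply,
      Pi.sub_apply, Int.cast_sub, smul_eq_mul]
    rw [h1, h2]
    field_simp
    ring

theorem latticeDist_comm (u w : Fin d → ℤ) : latticeDist u w = latticeDist w u :=
  norm_sub_rev _ _

theorem latticeDist_le_mul {D : ℝ} {u w : Fin d → ℤ}
    (h : ‖latticePoint (blockIndex r w - blockIndex r u)‖ ≤ D) :
    latticeDist u w ≤ (D + √d) * r := by
  obtain ⟨e, he, heq⟩ := exists_latticePoint_sub_eq (r := r) u w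
  rw [latticeDist_comm, latticeDist, heq, norm_smul, Real.norm_natCast, mul_comm]
  exact mul_le_mul_of_nonneg_right ((norm_add_le _ _).trans (add_le_add h he)) r.cast_nonneg

theorem norm_blockIndex_sub_le {D : ℝ} {u w : Fin d → ℤ} (h : latticeDist u w ≤ D * r) :
    ‖latticePoint (blockIndex r w - blockIndex r u)‖ ≤ D + √d := by
  obtain ⟨e, he, heq⟩ := exists_latticePoint_sub_eq (r := r) u w
  have hr : (0 : ℝ) < r := by exact_mod_cast NeZero.pos r
  rw [latticeDist_comm, latticeDist, heq, norm_smul, Real.norm_natCast, mul_comm] at h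
  have h1 := le_of_mul_le_mul_right h hr
  have h2 := norm_sub_le (latticePoint (blockIndex r w - blockIndex r u) + e) e
  rw [add_sub_cancel_right] at h2
  linarith

/-- If a ball around the difference of the block indices lies in a double cone, then so does the
difference of the points, whatever their positions in the blocks. The margin `1` in the radius
keeps the points at distance at least `r`, because the apex is not in the cone. -/
theorem sub_mem_points_of_ball {V : DoubleCone d} {u w : Fin d → ℤ}
    (H : ∀ e : EuclideanSpace ℝ (Fin d), ‖e‖ ≤ √d + 1 →
      latticePoint (blockIndex r w - blockIndex r u) + e ∈ V.points) :
    latticePoint w - latticePoint u ∈ V.points ∧ (r : ℝ) ≤ latticeDist u w := by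
  obtain ⟨e, he, heq⟩ := exists_latticePoint_sub_eq (r := r) u w
  have hr : (0 : ℝ) < r := by exact_mod_cast NeZero.pos r
  refine ⟨heq ▸ smul_mem_points hr (H e (by linarith)), ?_⟩
  rw [latticeDist_comm, latticeDist, heq, norm_smul, Real.norm_natCast]
  refine le_mul_of_one_le_right hr.le ?_
  by_contra! hlt
  set g := latticePoint (blockIndex r w - blockIndex r u)
  refine zero_notMem_points V ?_
  have h := H (e - (g + e)) ((norm_sub_le _ _).trans (by linarith))
  rwa [add_sub, sub_self] at h

end Blocks

/-! ### Routed edges and their multiplicity -/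

/-- The data recorded about an oriented edge from `u` to `w` on the path from `x` to `y` at
scale `r`: it stays within a bounded number of blocks of `x` and `y`, its length is comparable
to `r`, and the positions of its ends in their blocks form one of four pairs, each of which
determines the positions of `x` and `y`. -/
structure IsRoutedEdge {d : ℕ} (r : ℕ) (D : ℝ) (x y u w : Fin d → ℤ) : Prop where
  near_left : ‖latticePoint (blockIndex r u - blockIndex r x)‖ ≤ D
  near_right : ‖latticePoint (blockIndex r u - blockIndex r y)‖ ≤ D
  le_dist : (r : ℝ) ≤ latticeDist u w
  dist_le : latticeDist u w ≤ (D + √d) * r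
  residues : (residue r u = residue r x ∧ residue r w = residue r x + residue r y) ∨
    (residue r u = residue r x + residue r y ∧ residue r w = residue r x) ∨
    (residue r u = residue r x ∧ residue r w = residue r y) ∨
    (residue r u = residue r x + residue r y ∧ residue r w = residue r y)

/-- A given oriented edge is routed, at a given scale, for boundedly many pairs `(x, y)`: the pair
is recovered from the offsets of its blocks and from the positions of the ends of the edge. -/
theorem exists_finset_of_isRoutedEdge (d : ℕ) (D : ℝ) :
    ∃ M : ℕ, ∀ (r : ℕ) [NeZero r] (u w : Fin d → ℤ),
      ∃ T : Finset ((Fin d → ℤ) × (Fin d → ℤ)), T.card ≤ M ∧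
        ∀ x y, IsRoutedEdge r D x y u w → (x, y) ∈ T := by
  classical
  set O := (finite_norm_latticePoint_le d D).toFinset
  refine ⟨O.card * O.card * 4, fun r _ u w => ?_⟩
  set q := residue r u
  set q' := residue r w
  let P : Finset ((Fin d → ZMod r) × (Fin d → ZMod r)) :=
    {(q, q' - q), (q', q - q'), (q, q'), (q - q', q')}
  refine ⟨((O ×ˢ O) ×ˢ P).image fun z =>
    (blockPoint r (blockIndex r u - z.1.1) z.2.1, blockPoint r (blockIndex r u - z.1.2) z.2.2),
    Finset.card_image_le.trans ?_, fun x y h => ?_⟩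
  · rw [Finset.card_product, Finset.card_product]
    exact Nat.mul_le_mul_left _ Finset.card_le_four
  · refine Finset.mem_image.mpr ⟨((blockIndex r u - blockIndex r x, blockIndex r u - blockIndex r y),
      (residue r x, residue r y)), ?_, ?_⟩
    · simp only [Finset.mem_product]
      refine ⟨⟨by simpa [O] using h.near_left, by simpa [O] using h.near_right⟩, ?_⟩
      simp only [P, Finset.mem_insert, Finset.mem_singleton, Prod.mk.injEq]
      rcases h.residues with ⟨h1, h2⟩ | ⟨h1, h2⟩ | ⟨h1, h2⟩ | ⟨h1, h2⟩
      · left; simp [q, q', h1, h2]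
      · right; left; simp [q, q', h1, h2]
      · right; right; left; simp [q, q', h1, h2]
      · right; right; right; simp [q, q', h1, h2]
    · simp only [sub_sub_cancel, blockPoint_blockIndex_residue]

/-! ### The greedy walk -/

/-- A step `h` that makes progress towards the origin brings `a` closer to it, unless `a` is
already near. -/
theorem norm_latticePoint_add_sq_lt {d : ℕ} {a h : Fin d → ℤ} {C : ℝ}
    (hC : ‖latticePoint h‖ ≤ C) (ha : C ^ 2 < ‖latticePoint a‖)
    (hh : ‖latticePoint a‖ ≤ inner ℝ (latticePoint h) (-latticePoint a)) :
    ‖latticePoint (a + h)‖ ^ 2 < ‖latticePoint a‖ ^ 2 := by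
  rw [latticePoint_add, norm_add_sq_real]
  rw [inner_neg_right, real_inner_comm] at hh
  have h1 : ‖latticePoint h‖ ^ 2 ≤ C ^ 2 := pow_le_pow_left₀ (norm_nonneg _) hC 2
  linarith [norm_nonneg (latticePoint a)]

/-- Two points at distance at most `2 * r` are joined by a path of bounded length that consists of
routed edges at scale `r`. -/
theorem exists_walk_of_isRoutedEdge (d : ℕ) {ϑ : ℝ} (hϑ : 0 < ϑ) :
    ∃ (N : ℕ) (D : ℝ), 0 ≤ D ∧ ∀ Γ : (Fin d → ℤ) → DoubleCone d, (∀ x, ϑ ≤ (Γ x).apex) →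
      ∀ (r : ℕ) [NeZero r] (x y : Fin d → ℤ), latticeDist x y ≤ 2 * r →
        ∃ p : (coneGraph Γ).Walk x y, p.length ≤ N ∧
          ∀ e ∈ p.edges, ∃ u w, e = s(u, w) ∧ IsRoutedEdge r D x y u w := by
  have hsd : 0 ≤ √(d : ℝ) := Real.sqrt_nonneg _
  obtain ⟨C, hC0, hC⟩ :=
    exists_lattice_ball_subset_points d hϑ (ρ := √d + 1) (by positivity)
  -- Greedy steps make progress only at distance more than `C ^ 2` from the target, so the target
  -- has to lie in the cone of `y` together with a ball of that radius.
  obtain ⟨C', hC0', hC'⟩ :=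
    exists_lattice_ball_subset_points d hϑ (ρ := C ^ 2 + (√d + 1)) (by positivity)
  set D₀ := C + (2 + √d) + C' with hD₀
  have hD₀0 : 0 ≤ D₀ := by positivity
  refine ⟨⌈D₀ ^ 2⌉₊ + 2, 3 * D₀, by positivity, fun Γ hΓ r _ x y hxy => ?_⟩
  set cx := blockIndex r x with hcx
  set cy := blockIndex r y with hcy
  have hxy' : ‖latticePoint (cy - cx)‖ ≤ 2 + √d := norm_blockIndex_sub_le hxy
  obtain ⟨o, ho, hoball, -⟩ := hC' (Γ y) (hΓ y) 0
  set p := cy + o with hp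
  have greedy : ∀ u : Fin d → ℤ, ∀ b : Fin d → ℤ, ∃ h : Fin d → ℤ, ‖latticePoint h‖ ≤ C ∧
      (∀ e : EuclideanSpace ℝ (Fin d), ‖e‖ ≤ √d + 1 → latticePoint h + e ∈ (Γ u).points) ∧
      ‖latticePoint (b - p)‖ ≤ inner ℝ (latticePoint h) (-latticePoint (b - p)) := by
    intro u b
    obtain ⟨h, h1, h2, h3⟩ := hC (Γ u) (hΓ u) (-latticePoint (b - p))
    refine ⟨h, h1, h2, le_trans ?_ h3⟩
    rw [norm_neg]
    exact le_mul_of_one_le_left (norm_nonneg _) (by linarith)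
  have near : ∀ b, ‖latticePoint (b - p)‖ ≤ D₀ →
      ‖latticePoint (b - cx)‖ ≤ 3 * D₀ ∧ ‖latticePoint (b - cy)‖ ≤ 3 * D₀ := by
    intro b hb
    have h1 : b - cy = (b - p) + o := by rw [hp]; abel
    have h2 : b - cx = (b - p) + o + (cy - cx) := by rw [hp]; abel
    rw [h1, h2, latticePoint_add, latticePoint_add]
    have h3 := norm_add_le (latticePoint (b - p)) (latticePoint o)
    have h4 := norm_add_le (latticePoint (b - p) + latticePoint o) (latticePoint (cy - cx))
    constructor <;> linarith
  -- The positions in the blocks alternate between that of `x` and the sum of those of `x` and `y`.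
  let tag : Bool → (Fin d → ZMod r) := fun t =>
    if t then residue r x else residue r x + residue r y
  -- A step along the cone of `u` to the block at offset `h`.
  have step : ∀ (u : Fin d → ℤ) (q : Fin d → ZMod r) (h : Fin d → ℤ), ‖latticePoint h‖ ≤ C →
      (∀ e : EuclideanSpace ℝ (Fin d), ‖e‖ ≤ √d + 1 → latticePoint h + e ∈ (Γ u).points) →
      (‖latticePoint (blockIndex r u - cx)‖ ≤ 3 * D₀ ∧
        ‖latticePoint (blockIndex r u - cy)‖ ≤ 3 * D₀) →
      (residue r u = residue r x ∧ q = residue r x + residue r y ∨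
        residue r u = residue r x + residue r y ∧ q = residue r x) →
      (coneGraph Γ).Adj u (blockPoint r (blockIndex r u + h) q) ∧
        IsRoutedEdge r (3 * D₀) x y u (blockPoint r (blockIndex r u + h) q) := by
    intro u q h h1 h2 hnear hq
    have hb : blockIndex r (blockPoint r (blockIndex r u + h) q) - blockIndex r u = h := by
      rw [blockIndex_blockPoint, add_sub_cancel_left]
    have hball := sub_mem_points_of_ball (r := r) (V := Γ u) (u := u)
      (w := blockPoint r (blockIndex r u + h) q) (by rw [hb]; exact h2)
    refine ⟨coneGraph_adj_of_sub_mem hball.1, hnear.1, hnear.2, hball.2,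
      latticeDist_le_mul (by rw [hb]; linarith), ?_⟩
    rw [residue_blockPoint]
    rcases hq with hq | hq
    · exact Or.inl hq
    · exact Or.inr (Or.inl hq)
  -- The last edge belongs to the cone of `y`.
  have arrive : ∀ (n : ℕ) (t : Bool) (b : Fin d → ℤ), ‖latticePoint (b - p)‖ ≤ C ^ 2 →
      ‖latticePoint (b - p)‖ ≤ D₀ →
      ∃ W : (coneGraph Γ).Walk (blockPoint r b (tag t)) y, W.length ≤ n + 1 ∧
        ∀ e ∈ W.edges, ∃ u w, e = s(u, w) ∧ IsRoutedEdge r (3 * D₀) x y u w := by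
    intro n t b hb hbD
    have hball := sub_mem_points_of_ball (r := r) (V := Γ y) (u := y)
      (w := blockPoint r b (tag t)) (by
        intro e he
        have h1 : b - cy = o + (b - p) := by rw [hp]; abel
        rw [blockIndex_blockPoint, ← hcy, h1, latticePoint_add, add_assoc]
        exact hoball _ ((norm_add_le _ _).trans (add_le_add hb he)))
    have hadj := (coneGraph_adj_of_sub_mem hball.1).symm
    refine ⟨SimpleGraph.Walk.cons hadj SimpleGraph.Walk.nil, by simp, fun e he => ?_⟩
    rw [SimpleGraph.Walk.edges_cons, SimpleGraph.Walk.edges_nil, List.mem_singleton] at he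
    have hnear := near b hbD
    refine ⟨_, _, he, by rw [blockIndex_blockPoint]; exact hnear.1,
      by rw [blockIndex_blockPoint]; exact hnear.2, latticeDist_comm y _ ▸ hball.2, ?_, ?_⟩
    · rw [latticeDist_comm]
      exact latticeDist_le_mul (by rw [blockIndex_blockPoint]; exact hnear.2)
    · rw [residue_blockPoint]
      cases t <;> simp [tag]
  -- The greedy walk, by induction on a bound on the squared distance to the target.
  have key : ∀ (n : ℕ) (t : Bool) (b : Fin d → ℤ), ‖latticePoint (b - p)‖ ^ 2 ≤ n →
      ‖latticePoint (b - p)‖ ≤ D₀ →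
      ∃ W : (coneGraph Γ).Walk (blockPoint r b (tag t)) y, W.length ≤ n + 1 ∧
        ∀ e ∈ W.edges, ∃ u w, e = s(u, w) ∧ IsRoutedEdge r (3 * D₀) x y u w := by
    intro n
    induction n with
    | zero =>
      intro t b hb hbD
      have h0 : ‖latticePoint (b - p)‖ = 0 := by
        rw [Nat.cast_zero] at hb
        exact pow_eq_zero_iff two_ne_zero |>.mp (le_antisymm hb (sq_nonneg _))
      exact arrive 0 t b (by rw [h0]; positivity) hbD
    | succ n ih =>
      intro t b hb hbD
      rcases le_or_gt ‖latticePoint (b - p)‖ (C ^ 2) with hle | hgt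
      · exact arrive (n + 1) t b hle hbD
      · obtain ⟨h, h1, h2, h3⟩ := greedy (blockPoint r b (tag t)) b
        have hlt := norm_latticePoint_add_sq_lt h1 hgt h3
        rw [sub_add_eq_add_sub] at hlt
        -- Squared distances of block indices are natural numbers, so they drop by at least one.
        have hn : ‖latticePoint (b + h - p)‖ ^ 2 ≤ n := by
          rw [norm_latticePoint_sq] at hlt hb ⊢
          rw [norm_latticePoint_sq] at hlt
          norm_cast at hlt hb ⊢
          omega
        have hD : ‖latticePoint (b + h - p)‖ ≤ D₀ :=
          (lt_of_pow_lt_pow_left₀ 2 (norm_nonneg _) hlt).le.trans hbD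
        obtain ⟨W, hW, hWe⟩ := ih (!t) (b + h) hn hD
        obtain ⟨hadj, hedge⟩ := step (blockPoint r b (tag t)) (tag !t) h h1 h2
          (by rw [blockIndex_blockPoint]; exact near b hbD)
          (by rw [residue_blockPoint]; cases t <;> simp [tag])
        rw [blockIndex_blockPoint] at hadj hedge
        refine ⟨SimpleGraph.Walk.cons hadj W, by simpa using hW, fun e he => ?_⟩
        rw [SimpleGraph.Walk.edges_cons, List.mem_cons] at he
        rcases he with rfl | he
        · exact ⟨_, _, rfl, hedge⟩
        · exact hWe e he
  obtain ⟨h, h1, h2, -⟩ := greedy x cx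
  have hx : ‖latticePoint (cx - cx)‖ ≤ 3 * D₀ ∧ ‖latticePoint (cx - cy)‖ ≤ 3 * D₀ := by
    rw [latticePoint_sub cx cy, norm_sub_rev, ← latticePoint_sub, sub_self]
    refine ⟨?_, by linarith⟩
    have : latticePoint (0 : Fin d → ℤ) = 0 := by ext; simp [latticePoint]
    rw [this, norm_zero]
    positivity
  obtain ⟨hadj, hedge⟩ := step x (tag false) h h1 h2 hx (Or.inl ⟨rfl, by simp [tag]⟩)
  have hstart : ‖latticePoint (cx + h - p)‖ ≤ D₀ := by
    have h3 : cx + h - p = h - (cy - cx) - o := by rw [hp]; abel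
    rw [h3, latticePoint_sub, latticePoint_sub _ (cy - cx)]
    have h4 := norm_sub_le (latticePoint h - latticePoint (cy - cx)) (latticePoint o)
    have h5 := norm_sub_le (latticePoint h) (latticePoint (cy - cx))
    linarith
  obtain ⟨W, hW, hWe⟩ := key ⌈D₀ ^ 2⌉₊ false (cx + h)
    ((pow_le_pow_left₀ (norm_nonneg _) hstart 2).trans (Nat.le_ceil _)) hstart
  refine ⟨SimpleGraph.Walk.cons hadj W, by simpa using hW, fun e he => ?_⟩
  rw [SimpleGraph.Walk.edges_cons, List.mem_cons] at he
  rcases he with rfl | he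
  · exact ⟨_, _, rfl, hedge⟩
  · exact hWe e he

/-! ### All scales together -/

theorem exists_two_pow_le_le_two_mul {R : ℝ} (hR : 1 ≤ R) : ∃ k : ℕ, (2 : ℝ) ^ k ≤ R ∧ R ≤ 2 * 2 ^ k := by
  obtain ⟨k, h1, h2⟩ := exists_nat_pow_near hR one_lt_two
  exact ⟨k, h1, by rw [pow_succ] at h2; linarith⟩

/-- A given length is comparable to boundedly many powers of two. -/
theorem exists_Icc_of_scale {c : ℕ} {Λ : ℝ} (hΛ : Λ ≤ 2 ^ c) (l : ℝ) :
    ∃ k₀ : ℕ, ∀ k : ℕ, (2 : ℝ) ^ k ≤ l → l ≤ Λ * 2 ^ k → k ∈ Finset.Icc k₀ (k₀ + c) := by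
  classical
  by_cases hex : ∃ k : ℕ, (2 : ℝ) ^ k ≤ l ∧ l ≤ Λ * 2 ^ k
  · refine ⟨Nat.find hex, fun k h1 h2 => Finset.mem_Icc.mpr ⟨Nat.find_min' hex ⟨h1, h2⟩, ?_⟩⟩
    have h3 := (Nat.find_spec hex).2
    have h4 : (2 : ℝ) ^ k ≤ 2 ^ (Nat.find hex + c) := by
      rw [pow_add, mul_comm]
      exact h1.trans (h3.trans (mul_le_mul_of_nonneg_right hΛ (by positivity)))
    exact (pow_le_pow_iff_right₀ one_lt_two).mp h4
  · exact ⟨0, fun k h1 h2 => absurd ⟨k, h1, h2⟩ hex⟩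

theorem mainTheorem4 (d : ℕ) (hd : 1 ≤ d) (ϑ : ℝ) (hϑ : 0 < ϑ) (R₀ : ℝ) (hR₀ : 0 < R₀) :
    ∃ (N M : ℕ) (lam : ℝ), 0 < N ∧ 0 < M ∧ R₀ ≤ lam ∧
      ∀ Γ : (Fin d → ℤ) → DoubleCone d, (∀ x, ϑ ≤ (Γ x).apex) →
        ∃ p : ∀ x y : Fin d → ℤ, (coneGraph Γ).Walk x y,
          (∀ x y, (p x y).length ≤ N) ∧
          (∀ e ∈ (coneGraph Γ).edgeSet,
            {xy : (Fin d → ℤ) × (Fin d → ℤ) | e ∈ (p xy.1 xy.2).edges}.encard ≤ M) ∧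
          (∀ x y u w, s(u, w) ∈ (p x y).edges →
            lam⁻¹ * latticeDist x y ≤ latticeDist u w ∧
              latticeDist u w ≤ lam * latticeDist x y) := by
  classical
  obtain ⟨N, D, hD, hwalk⟩ := exists_walk_of_isRoutedEdge d hϑ
  obtain ⟨M, hM⟩ := exists_finset_of_isRoutedEdge d D
  set Λ := D + √d with hΛ
  have hΛ0 : 0 ≤ Λ := by positivity
  obtain ⟨c, hc⟩ := pow_unbounded_of_one_lt Λ (one_lt_two (α := ℝ))
  have hlam2 : 2 ≤ max R₀ (max 2 Λ) := (le_max_left _ _).trans (le_max_right _ _)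
  have hlamΛ : Λ ≤ max R₀ (max 2 Λ) := (le_max_right _ _).trans (le_max_right _ _)
  refine ⟨N + 1, (c + 1) * (M + M) + 1, max R₀ (max 2 Λ), by omega, by omega, le_max_left _ _,
    fun Γ hΓ => ?_⟩
  have hpath : ∀ x y : Fin d → ℤ, ∃ p : (coneGraph Γ).Walk x y, p.length ≤ N ∧
      ∀ e ∈ p.edges, ∃ k : ℕ, (2 : ℝ) ^ k ≤ latticeDist x y ∧ latticeDist x y ≤ 2 * 2 ^ k ∧
        ∃ u w, e = s(u, w) ∧ IsRoutedEdge (2 ^ k) D x y u w := by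
    intro x y
    by_cases hxy : x = y
    -- No edge is short enough for a pair `x = y`, so the path has to be the trivial one.
    · subst hxy
      exact ⟨SimpleGraph.Walk.nil, by simp, by simp⟩
    · have h1 : 1 ≤ latticeDist x y := by
        rw [latticeDist, ← latticePoint_sub]
        exact one_le_norm_latticePoint (sub_ne_zero.mpr hxy)
      obtain ⟨k, hk1, hk2⟩ := exists_two_pow_le_le_two_mul h1
      obtain ⟨p, hp, hpe⟩ := hwalk Γ hΓ (2 ^ k) x y (by push_cast; exact hk2)
      exact ⟨p, hp, fun e he => ⟨k, hk1, hk2, hpe e he⟩⟩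
  choose p hpN hpe using hpath
  refine ⟨p, fun x y => (hpN x y).trans (Nat.le_succ N), fun e _ => ?_, fun x y u w he => ?_⟩
  · induction e using Sym2.ind with
    | _ u w =>
      choose T hTcard hT using fun k : ℕ => hM (2 ^ k)
      obtain ⟨k₀, hk₀⟩ := exists_Icc_of_scale hc.le (latticeDist u w)
      let B := (Finset.Icc k₀ (k₀ + c)).biUnion fun k => T k u w ∪ T k w u
      have hB : B.card ≤ (c + 1) * (M + M) := by
        have h := Finset.card_biUnion_le_card_mul (Finset.Icc k₀ (k₀ + c))
          (fun k => T k u w ∪ T k w u) (M + M) fun k _ =>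
            (Finset.card_union_le _ _).trans (add_le_add (hTcard k u w) (hTcard k w u))
        rw [Nat.card_Icc] at h
        convert h using 2
        omega
      have hsub : {xy : (Fin d → ℤ) × (Fin d → ℤ) | s(u, w) ∈ (p xy.1 xy.2).edges} ⊆ B := by
        rintro ⟨x, y⟩ hxy
        obtain ⟨k, -, -, u', w', he, hr⟩ := hpe x y _ hxy
        have h1 := hr.le_dist
        have h2 := hr.dist_le
        push_cast at h1 h2
        rw [Finset.mem_coe, Finset.mem_biUnion]
        rcases Sym2.eq_iff.mp he with ⟨rfl, rfl⟩ | ⟨rfl, rfl⟩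
        · exact ⟨k, hk₀ k h1 h2, Finset.mem_union_left _ (hT k _ _ x y hr)⟩
        · rw [latticeDist_comm] at h1 h2
          exact ⟨k, hk₀ k h1 h2, Finset.mem_union_right _ (hT k _ _ x y hr)⟩
      refine (Set.encard_le_encard hsub).trans ?_
      rw [Set.encard_coe_eq_coe_finsetCard]
      exact_mod_cast hB.trans (Nat.le_succ _)
  · obtain ⟨k, hk1, hk2, u', w', he, hr⟩ := hpe x y _ he
    have hdist : latticeDist u w = latticeDist u' w' := by
      rcases Sym2.eq_iff.mp he with ⟨rfl, rfl⟩ | ⟨rfl, rfl⟩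
      · rfl
      · exact latticeDist_comm _ _
    have h1 := hr.le_dist
    have h2 := hr.dist_le
    push_cast at h1 h2
    have h0 : (0 : ℝ) < 2 ^ k := by positivity
    rw [hdist, inv_mul_le_iff₀ (by linarith)]
    constructor
    · calc latticeDist x y ≤ 2 * 2 ^ k := hk2
        _ ≤ max R₀ (max 2 Λ) * latticeDist u' w' := mul_le_mul hlam2 h1 h0.le (by linarith)
    · calc latticeDist u' w' ≤ Λ * 2 ^ k := h2
        _ ≤ max R₀ (max 2 Λ) * latticeDist x y := mul_le_mul hlamΛ hk1 h0.le (by linarith)
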